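/- Let $\varepsilon>0$, let $\lambda,c:[0,1]\to\mathbb R$ be continuous and let $K$ be a real kernel of class $C^2$ on the closed triangle $\Omega_L=\{0\le x\le 1,\ 0\le y\le x\}$. Put $$\delta_0(x)=\varepsilon K(x,0),\qquad \delta_1(x)=\lambda(x)+c(x)+2\varepsilon\tfrac{d}{dx}K(x,x),\qquad \delta_2(x,y)=\varepsilon K_{xx}(x,y)-\varepsilon K_{yy}(x,y)-(\lambda(y)+c(x))K(x,y).$$ Consider the transformed system with state $w(\cdot,t)$, in which $u$ is related to $w$ by the Volterra transformation $w(x,t)=u(x,t)-\int_0^xK(x,y)u(y,t)\,dy$: $$w_t(x,t)-\varepsilon w_{xx}(x,t)+c(x)w(x,t)=\delta_0(x)u_x(0,t)+\delta_1(x)u(x,t)+\int_0^x\delta_2(x,y)u(y,t)\,dy,\qquad w(0,t)=w(1,t)=0 .$$ Solutions are classical for $t>0$ ($w(\cdot,t)\in C^2[0,1]$ and $w_t$ continuous on $[0,1]\times(0,\infty)$) and attain an arbitrary initial state $w(\cdot,0)\in L^2(0,1)$ in the $L^2$ sense as $t\downarrow0$. Let $u(x,t)=w(x,t)+\int_0^xL(x,y)w(y,t)\,dy$,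 with $L$ continuous on $\Omega_L$, be the inverse transformation, and let $$L(x,y)=\breve L(x,y)-\sigma,\qquad \breve L(x,y)\ge 0 \text{ on }\Omega_L,\qquad \sigma\ge0,\qquad m_{0,0}=\int_0^1\!\!\int_0^x\breve L(x,y)\,dy\,dx .$$ Let $\underline c$ be such that $c(x)\ge\underline c>-\varepsilon\pi^2/4$ for all $x\in[0,1]$, let $\overline{\delta_1}=\max_{[0,1]}|\delta_1|$, $\overline{\delta_2}=\max_{\Omega_L}|\delta_2|$, and suppose that $\delta_0(x)=0$ for all $x\in[0,1]$. If for some $\theta\in[0,1]$ $$\overline{\delta_1}+\overline{\delta_2}\le\min\left\{\frac{\varepsilon\theta\left(\frac{\pi^2}{4}+1\right)+(\underline c-\varepsilon)}{1+\sigma},\ \frac{\varepsilon(1-\theta)}{m_{0,0}+\frac{\sigma+1/2}{4}}\right\},$$ then the transformed system is exponentially stable in the $L^2$ norm: there are constants $M,\alpha>0$ such that every solution satisfies $\|w(\cdot,t)\|_{L^2(0,1)}\le M e^{-\alpha t}\|w(\cdot,0)\|_{L^2(0,1)}$ for all $t\ge0$. The same holds if $c(x)$ is replaced by $c(y)$ in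 the formula for $\delta_2$ throughout. -/

import Mathlib

namespace Backstepping

open Set Filter Topology MeasureTheory

/-- The closed lower triangle `Ω_L = {0 ≤ x ≤ 1, 0 ≤ y ≤ x}`. -/
def triangle : Set (ℝ × ℝ) :=
  {p | 0 ≤ p.1 ∧ p.1 ≤ 1 ∧ 0 ≤ p.2 ∧ p.2 ≤ p.1}

/-- The partial derivative with respect to the first variable, on the closed triangle.
The triangle is convex with nonempty interior, so derivatives within it are unique,
also at boundary points. -/
noncomputable def partialX (F : ℝ → ℝ → ℝ) (x y : ℝ) : ℝ :=
  fderivWithin ℝ (Function.uncurry F) triangle (x, y) (1, 0)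

/-- The partial derivative with respect to the second variable, on the closed triangle. -/
noncomputable def partialY (F : ℝ → ℝ → ℝ) (x y : ℝ) : ℝ :=
  fderivWithin ℝ (Function.uncurry F) triangle (x, y) (0, 1)

/-- The Volterra integral operator `(V_K f)(x) = ∫₀ˣ K(x,y) f(y) dy`. -/
noncomputable def volterra (K : ℝ → ℝ → ℝ) (f : ℝ → ℝ) (x : ℝ) : ℝ :=
  ∫ y in (0 : ℝ)..x, K x y * f y

/-- `L` is a (continuous) kernel of the inverse transformation of `w = u - V_K u`, that is,
on continuous functions on `[0,1]`, `w = u - V_K u` holds exactly when `u = w + V_L w`. -/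
def IsInverseKernel (K L : ℝ → ℝ → ℝ) : Prop :=
  ContinuousOn (Function.uncurry L) triangle ∧
    ∀ u w : ℝ → ℝ, ContinuousOn u (Icc 0 1) → ContinuousOn w (Icc 0 1) →
      ((∀ x ∈ Icc (0 : ℝ) 1, w x = u x - volterra K u x) ↔
        (∀ x ∈ Icc (0 : ℝ) 1, u x = w x + volterra L w x))

/-- `δ₀(x) = ε K(x,0)`. -/
noncomputable def residual0 (ε : ℝ) (K : ℝ → ℝ → ℝ) (x : ℝ) : ℝ :=
  ε * K x 0

/-- `δ₁(x) = λ(x) + c(x) + 2 ε (d/dx) K(x,x)`. -/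
noncomputable def residual1 (ε : ℝ) (lam c : ℝ → ℝ) (K : ℝ → ℝ → ℝ) (x : ℝ) : ℝ :=
  (lam x + c x) + 2 * ε * derivWithin (fun s => K s s) (Icc 0 1) x

/-- `δ₂(x,y) = ε K_xx(x,y) - ε K_yy(x,y) - (λ(y) + c(x)) K(x,y)`. -/
noncomputable def residual2 (ε : ℝ) (lam c : ℝ → ℝ) (K : ℝ → ℝ → ℝ) (x y : ℝ) : ℝ :=
  ε * partialX (partialX K) x y - ε * partialY (partialY K) x y - (lam y + c x) * K x y

/-- The variant `δ₂(x,y) = ε K_xx(x,y) - ε K_yy(x,y) - (λ(y) + c(y)) K(x,y)`; it is the same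
function when `c` is constant. -/
noncomputable def residual2' (ε : ℝ) (lam c : ℝ → ℝ) (K : ℝ → ℝ → ℝ) (x y : ℝ) : ℝ :=
  ε * partialX (partialX K) x y - ε * partialY (partialY K) x y - (lam y + c y) * K x y

/-- `max_{x ∈ [0,1]} |f(x)|` (for continuous `f`). -/
noncomputable def maxAbs (f : ℝ → ℝ) : ℝ :=
  sSup ((fun x => |f x|) '' Icc 0 1)

/-- `max_{(x,y) ∈ Ω_L} |F(x,y)|` (for continuous `F`). -/
noncomputable def maxAbsTriangle (F : ℝ → ℝ → ℝ) : ℝ :=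
  sSup ((fun p : ℝ × ℝ => |F p.1 p.2|) '' triangle)

/-- The moment of order zero `∫₀¹ ∫₀ˣ F(x,y) dy dx`. -/
noncomputable def moment00 (F : ℝ → ℝ → ℝ) : ℝ :=
  ∫ x in (0 : ℝ)..1, ∫ y in (0 : ℝ)..x, F x y

/-- The norm of `L²(0,1)`. -/
noncomputable def l2norm (f : ℝ → ℝ) : ℝ :=
  Real.sqrt (∫ x in (0 : ℝ)..1, f x ^ 2)

/-- `w`, with the associated original state `u`, is a solution for `t ≥ 0` of

`w_t - ε w_xx + c w = δ₀(x) u_x(0,t) + δ₁(x) u + ∫₀ˣ δ₂(x,y) u(y,t) dy`,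
`w(0,t) = w(1,t) = 0`, where `w = u - V_K u`.

Time is the first argument of `u` and `w`. The initial state is an arbitrary element of
`L²(0,1)`, attained in the `L²` sense, and the solution is classical for `t > 0`. -/
structure IsTransformedSolution (ε : ℝ) (c : ℝ → ℝ) (K : ℝ → ℝ → ℝ)
    (δ₀ δ₁ : ℝ → ℝ) (δ₂ : ℝ → ℝ → ℝ) (u w : ℝ → ℝ → ℝ) : Prop where
  initial_memLp : MemLp (w 0) 2 (volume.restrict (Icc 0 1))
  initial_tendsto :
    Tendsto (fun t => l2norm (fun x => w t x - w 0 x)) (𝓝[>] 0) (𝓝 0)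
  contDiffOn_u : ∀ t > 0, ContDiffOn ℝ 1 (u t) (Icc 0 1)
  contDiffOn_w : ∀ t > 0, ContDiffOn ℝ 2 (w t) (Icc 0 1)
  differentiable_time : ∀ t > 0, ∀ x ∈ Icc (0 : ℝ) 1, DifferentiableAt ℝ (fun s => w s x) t
  continuousOn_time_deriv :
    ContinuousOn (fun p : ℝ × ℝ => deriv (fun s => w s p.2) p.1) (Ioi 0 ×ˢ Icc 0 1)
  transformation : ∀ t > 0, ∀ x ∈ Icc (0 : ℝ) 1, w t x = u t x - volterra K (u t) x
  boundary_zero : ∀ t > 0, w t 0 = 0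
  boundary_one : ∀ t > 0, w t 1 = 0
  equation : ∀ t > 0, ∀ x ∈ Ioo (0 : ℝ) 1,
    deriv (fun s => w s x) t - ε * iteratedDerivWithin 2 (w t) (Icc 0 1) x + c x * w t x =
      δ₀ x * derivWithin (u t) (Icc 0 1) 0 + δ₁ x * u t x +
        ∫ y in (0 : ℝ)..x, δ₂ x y * u t y

/-- Exponential stability of the transformed system in the norm of `L²(0,1)`: the constants
are the same for all solutions. -/
def IsExponentiallyStable (ε : ℝ) (c : ℝ → ℝ) (K : ℝ → ℝ → ℝ)
    (δ₀ δ₁ : ℝ → ℝ) (δ₂ : ℝ → ℝ → ℝ) : Prop :=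
  ∃ M > 0, ∃ α > 0, ∀ u w : ℝ → ℝ → ℝ, IsTransformedSolution ε c K δ₀ δ₁ δ₂ u w →
    ∀ t ≥ 0, l2norm (w t) ≤ M * Real.exp (-α * t) * l2norm (w 0)

end Backstepping

namespace Backstepping

open Set Filter Topology MeasureTheory

/-! The proof is an energy estimate. Write `Q = ∫ w²` and `A = ∫ w_x²`. Multiplying the equation by
`w` and integrating by parts gives `Q' / 2 = -ε A - ∫ c w² + ∫ w R`, where `R` collects the residual
terms; the trace `u_x(0,t)` drops out because `δ₀ = 0`.

Two estimates close the balance. Since `w` vanishes at both ends, `4 max w² ≤ A` (`four_mul_sq_le`);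
this also serves as a Poincaré inequality `Q ≤ A / 4`. Writing `u = w + V_L w` with `L = Lpos - σ`,
the nonnegative part of the kernel is paired with the maximum of `|w|` and the constant `σ` with `∫
|w|`. Hence `∫ w R ≤ D ((1 + σ) Q + m A / 4)`, with `D` the sum of the two residual maxima and `m`
the zeroth moment (`integral_mul_residual_le`).

The parameter `θ` splits the budget: the first bound on `D` controls the `Q` term, the second the
`A` term. What remains is `Q' ≤ -3 ε Q` (`energy_rate_le`). Gronwall on `(0, ∞)` and the `L²` limit
at time zero give decay with `M = 1` and `α = 3 ε / 2`. -/

/-! ### Geometry of the triangle and continuity of the residuals. -/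

lemma mem_triangle {x y : ℝ} (hx : x ∈ Icc (0 : ℝ) 1) (hy : y ∈ Icc 0 x) :
    (x, y) ∈ triangle :=
  ⟨hx.1, hx.2, hy.1, hy.2⟩

lemma isCompact_triangle : IsCompact triangle := by
  refine (isCompact_Icc (a := ((0 : ℝ), (0 : ℝ))) (b := (1, 1))).of_isClosed_subset ?_ ?_
  · have : triangle = {p : ℝ × ℝ | 0 ≤ p.1} ∩ {p | p.1 ≤ 1} ∩ {p | 0 ≤ p.2} ∩ {p | p.2 ≤ p.1} := by
      ext p; simp [triangle, and_assoc]
    rw [this]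
    exact (((isClosed_le continuous_const continuous_fst).inter
      (isClosed_le continuous_fst continuous_const)).inter
      (isClosed_le continuous_const continuous_snd)).inter
      (isClosed_le continuous_snd continuous_fst)
  · rintro ⟨x, y⟩ ⟨h1, h2, h3, h4⟩
    exact ⟨⟨h1, h3⟩, ⟨h2, h4.trans h2⟩⟩

lemma convex_triangle : Convex ℝ triangle := by
  rintro ⟨x, y⟩ ⟨h1, h2, h3, h4⟩ ⟨x', y'⟩ ⟨h1', h2', h3', h4'⟩ a b ha hb hab
  simp only at h1 h2 h3 h4 h1' h2' h3' h4'
  refine ⟨?_, ?_, ?_, ?_⟩ <;> simp only [Prod.smul_mk, Prod.mk_add_mk, smul_eq_mul]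
  · positivity
  · nlinarith
  · positivity
  · nlinarith

/-- Makes derivatives within the triangle well behaved up to the boundary, so that a `C²` kernel has
continuous second partials there. -/
lemma uniqueDiffOn_triangle : UniqueDiffOn ℝ triangle := by
  refine uniqueDiffOn_convex convex_triangle ⟨(1 / 2, 1 / 4), ?_⟩
  rw [mem_interior]
  refine ⟨{p : ℝ × ℝ | 0 < p.1} ∩ {p | p.1 < 1} ∩ {p | 0 < p.2} ∩ {p | p.2 < p.1}, ?_, ?_, ?_⟩
  · rintro p ⟨⟨⟨h1, h2⟩, h3⟩, h4⟩
    exact ⟨le_of_lt h1, le_of_lt h2, le_of_lt h3, le_of_lt h4⟩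
  · exact (((isOpen_lt continuous_const continuous_fst).inter
      (isOpen_lt continuous_fst continuous_const)).inter
      (isOpen_lt continuous_const continuous_snd)).inter
      (isOpen_lt continuous_snd continuous_fst)
  · norm_num

lemma contDiffOn_partialX {n m : WithTop ℕ∞} {F : ℝ → ℝ → ℝ}
    (hF : ContDiffOn ℝ n (Function.uncurry F) triangle) (h : m + 1 ≤ n) :
    ContDiffOn ℝ m (Function.uncurry (partialX F)) triangle :=
  (hF.fderivWithin uniqueDiffOn_triangle h).clm_apply contDiffOn_const

lemma contDiffOn_partialY {n m : WithTop ℕ∞} {F : ℝ → ℝ → ℝ}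
    (hF : ContDiffOn ℝ n (Function.uncurry F) triangle) (h : m + 1 ≤ n) :
    ContDiffOn ℝ m (Function.uncurry (partialY F)) triangle :=
  (hF.fderivWithin uniqueDiffOn_triangle h).clm_apply contDiffOn_const

lemma continuousOn_comp_fst {f : ℝ → ℝ} (hf : ContinuousOn f (Icc 0 1)) :
    ContinuousOn (fun p : ℝ × ℝ => f p.1) triangle :=
  hf.comp continuousOn_fst fun _ hp => ⟨hp.1, hp.2.1⟩

lemma continuousOn_comp_snd {f : ℝ → ℝ} (hf : ContinuousOn f (Icc 0 1)) :
    ContinuousOn (fun p : ℝ × ℝ => f p.2) triangle :=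
  hf.comp continuousOn_snd fun _ hp => ⟨hp.2.2.1, hp.2.2.2.trans hp.2.1⟩

lemma continuousOn_laplace_difference {K : ℝ → ℝ → ℝ} (ε : ℝ)
    (hK : ContDiffOn ℝ 2 (Function.uncurry K) triangle) :
    ContinuousOn (fun p : ℝ × ℝ => ε * partialX (partialX K) p.1 p.2 -
      ε * partialY (partialY K) p.1 p.2) triangle := by
  have h1 : ContDiffOn ℝ 0 (Function.uncurry (partialX (partialX K))) triangle :=
    contDiffOn_partialX (contDiffOn_partialX (m := 1) hK (by norm_num)) (by norm_num)
  have h2 : ContDiffOn ℝ 0 (Function.uncurry (partialY (partialY K))) triangle :=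
    contDiffOn_partialY (contDiffOn_partialY (m := 1) hK (by norm_num)) (by norm_num)
  exact (continuousOn_const.mul h1.continuousOn).sub (continuousOn_const.mul h2.continuousOn)

lemma continuousOn_residual2 {ε : ℝ} {lam c : ℝ → ℝ} {K : ℝ → ℝ → ℝ}
    (hlam : ContinuousOn lam (Icc 0 1)) (hc : ContinuousOn c (Icc 0 1))
    (hK : ContDiffOn ℝ 2 (Function.uncurry K) triangle) :
    ContinuousOn (Function.uncurry (residual2 ε lam c K)) triangle :=
  (continuousOn_laplace_difference ε hK).sub
    (((continuousOn_comp_snd hlam).add (continuousOn_comp_fst hc)).mul hK.continuousOn)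

lemma continuousOn_residual2' {ε : ℝ} {lam c : ℝ → ℝ} {K : ℝ → ℝ → ℝ}
    (hlam : ContinuousOn lam (Icc 0 1)) (hc : ContinuousOn c (Icc 0 1))
    (hK : ContDiffOn ℝ 2 (Function.uncurry K) triangle) :
    ContinuousOn (Function.uncurry (residual2' ε lam c K)) triangle :=
  (continuousOn_laplace_difference ε hK).sub
    (((continuousOn_comp_snd hlam).add (continuousOn_comp_snd hc)).mul hK.continuousOn)

lemma continuousOn_residual1 {ε : ℝ} {lam c : ℝ → ℝ} {K : ℝ → ℝ → ℝ}
    (hlam : ContinuousOn lam (Icc 0 1)) (hc : ContinuousOn c (Icc 0 1))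
    (hK : ContDiffOn ℝ 2 (Function.uncurry K) triangle) :
    ContinuousOn (residual1 ε lam c K) (Icc 0 1) := by
  have hdiag : ContDiffOn ℝ 2 (fun s => K s s) (Icc 0 1) :=
    hK.comp (f := fun s : ℝ => (s, s)) (contDiffOn_id.prodMk contDiffOn_id)
      fun x hx => mem_triangle hx ⟨hx.1, le_rfl⟩
  exact (hlam.add hc).add (continuousOn_const.mul
    (hdiag.continuousOn_derivWithin (uniqueDiffOn_Icc one_pos) (by norm_num)))

lemma abs_le_maxAbs {f : ℝ → ℝ} (hf : ContinuousOn f (Icc 0 1)) {x : ℝ}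
    (hx : x ∈ Icc (0 : ℝ) 1) : |f x| ≤ maxAbs f :=
  le_csSup (isCompact_Icc.image_of_continuousOn hf.abs).bddAbove (mem_image_of_mem _ hx)

lemma abs_le_maxAbsTriangle {F : ℝ → ℝ → ℝ} (hF : ContinuousOn (Function.uncurry F) triangle)
    {x y : ℝ} (h : (x, y) ∈ triangle) : |F x y| ≤ maxAbsTriangle F :=
  le_csSup (isCompact_triangle.image_of_continuousOn hF.abs).bddAbove
    (mem_image_of_mem (fun p : ℝ × ℝ => |F p.1 p.2|) h)

lemma continuousOn_slice {F : ℝ → ℝ → ℝ}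
    (hF : ContinuousOn (Function.uncurry F) triangle) {x : ℝ} (hx : x ∈ Icc (0 : ℝ) 1) :
    ContinuousOn (F x) (Icc 0 x) :=
  hF.comp (f := fun y => (x, y)) (by fun_prop) fun _ hy => mem_triangle hx hy

/-- A Volterra integral of a continuous kernel depends continuously on its endpoint. -/
lemma continuousOn_integral_triangle {F : ℝ → ℝ → ℝ}
    (hF : ContinuousOn (Function.uncurry F) triangle) :
    ContinuousOn (fun x => ∫ y in (0 : ℝ)..x, F x y) (Icc 0 1) := by
  -- The substitution `y = x s` moves the integral to the fixed interval `[0,1]`; projecting both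
  -- variables onto `[0,1]` makes the integrand continuous on the whole plane.
  let p : ℝ → ℝ := fun x => projIcc (0 : ℝ) 1 zero_le_one x
  have hp : Continuous p := continuous_subtype_val.comp continuous_projIcc
  have hmem : ∀ x, p x ∈ Icc (0 : ℝ) 1 := fun x => (projIcc (0 : ℝ) 1 zero_le_one x).2
  have hpe : ∀ x ∈ Icc (0 : ℝ) 1, p x = x := fun x hx => by simp [p, projIcc_of_mem _ hx]
  have hcont : Continuous (Function.uncurry fun x s => F (p x) (p x * p s)) := by
    refine hF.comp_continuous (f := fun q : ℝ × ℝ => (p q.1, p q.1 * p q.2)) (by fun_prop) ?_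
    intro q
    exact mem_triangle (hmem _) ⟨mul_nonneg (hmem _).1 (hmem _).1,
      mul_le_of_le_one_right (hmem _).1 (hmem _).2⟩
  have := (intervalIntegral.continuous_parametric_intervalIntegral_of_continuous'
    (μ := volume) hcont 0 1)
  refine ((continuous_id.mul this).continuousOn).congr fun x hx => ?_
  change _ = x * ∫ s in (0 : ℝ)..1, F (p x) (p x * p s)
  rw [hpe x hx]
  have h2 : ∫ s in (0 : ℝ)..1, F x (x * p s) = ∫ s in (0 : ℝ)..1, F x (x * s) := by
    refine intervalIntegral.integral_congr fun s hs => ?_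
    rw [uIcc_of_le zero_le_one] at hs
    simp only [hpe s hs]
  rw [h2, intervalIntegral.mul_integral_comp_mul_left]
  simp

/-! ### Integral inequalities on the unit interval. -/

lemma sq_integral_le {g : ℝ → ℝ} (hg : ContinuousOn g (Icc 0 1)) :
    (∫ x in (0 : ℝ)..1, g x) ^ 2 ≤ ∫ x in (0 : ℝ)..1, g x ^ 2 := by
  have hi : IntervalIntegrable g volume 0 1 := hg.intervalIntegrable_of_Icc zero_le_one
  have hi2 : IntervalIntegrable (fun x => g x ^ 2) volume 0 1 :=
    (hg.pow 2).intervalIntegrable_of_Icc zero_le_one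
  set I := ∫ x in (0 : ℝ)..1, g x with hI
  -- The variance of `g` is nonnegative.
  have h0 : 0 ≤ ∫ x in (0 : ℝ)..1, (g x - I) ^ 2 :=
    intervalIntegral.integral_nonneg zero_le_one fun x _ => sq_nonneg _
  have h1 : ∫ x in (0 : ℝ)..1, (g x - I) ^ 2 = (∫ x in (0 : ℝ)..1, g x ^ 2) - I ^ 2 := by
    have : ∀ x, (g x - I) ^ 2 = g x ^ 2 - 2 * I * g x + I ^ 2 := fun x => by ring
    simp_rw [this]
    rw [intervalIntegral.integral_add (hi2.sub (hi.const_mul _)) (by simp),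
      intervalIntegral.integral_sub hi2 (hi.const_mul _),
      intervalIntegral.integral_const_mul, ← hI]
    simp
    ring
  linarith

lemma hasDerivAt_derivWithin_Icc {f : ℝ → ℝ} (hf : DifferentiableOn ℝ f (Icc 0 1)) {x : ℝ}
    (hx : x ∈ Ioo (0 : ℝ) 1) : HasDerivAt f (derivWithin f (Icc 0 1) x) x :=
  (hf x (Ioo_subset_Icc_self hx)).hasDerivWithinAt.hasDerivAt (Icc_mem_nhds hx.1 hx.2)

/-- A function vanishing at both endpoints of the unit interval is bounded by half of the
`L²` norm of its derivative. -/
lemma four_mul_sq_le {f : ℝ → ℝ} (hf : ContDiffOn ℝ 1 f (Icc 0 1)) (h0 : f 0 = 0)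
    (h1 : f 1 = 0) {x : ℝ} (hx : x ∈ Icc (0 : ℝ) 1) :
    4 * f x ^ 2 ≤ ∫ y in (0 : ℝ)..1, derivWithin f (Icc 0 1) y ^ 2 := by
  set f' := derivWithin f (Icc 0 1)
  have hc' : ContinuousOn f' (Icc 0 1) :=
    hf.continuousOn_derivWithin (uniqueDiffOn_Icc one_pos) le_rfl
  have hd := hf.differentiableOn (by norm_num)
  have ftc : ∀ a b, 0 ≤ a → a ≤ b → b ≤ 1 → |f b - f a| ≤ ∫ y in a..b, |f' y| := by
    intro a b ha hab hb
    have hsub : Icc a b ⊆ Icc 0 1 := Icc_subset_Icc ha hb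
    rw [← intervalIntegral.integral_eq_sub_of_hasDerivAt_of_le hab (hf.continuousOn.mono hsub)
      (fun y hy => hasDerivAt_derivWithin_Icc hd ⟨ha.trans_lt hy.1, hy.2.trans_le hb⟩)
      ((hc'.mono hsub).intervalIntegrable_of_Icc hab)]
    exact intervalIntegral.abs_integral_le_integral_abs hab
  -- `|f x|` is bounded by the integral of `|f'|` on either side of `x`; adding the two bounds gives
  -- `2 |f x| ≤ ∫ |f'|`, hence the factor 4 after squaring.
  have hl := ftc 0 x le_rfl hx.1 hx.2
  have hr := ftc x 1 hx.1 hx.2 le_rfl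
  have hadd : (∫ y in (0 : ℝ)..x, |f' y|) + ∫ y in x..1, |f' y| = ∫ y in (0 : ℝ)..1, |f' y| :=
    intervalIntegral.integral_add_adjacent_intervals
      ((hc'.abs.mono (Icc_subset_Icc le_rfl hx.2)).intervalIntegrable_of_Icc hx.1)
      ((hc'.abs.mono (Icc_subset_Icc hx.1 le_rfl)).intervalIntegrable_of_Icc hx.2)
  rw [h0, sub_zero] at hl
  rw [h1, zero_sub, abs_neg] at hr
  have hsq := sq_integral_le hc'.abs
  simp only [sq_abs] at hsq
  have : (2 * |f x|) ^ 2 ≤ (∫ y in (0 : ℝ)..1, |f' y|) ^ 2 :=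
    pow_le_pow_left₀ (by positivity) (by linarith) 2
  nlinarith [sq_abs (f x)]

lemma integral_mul_second_deriv {f : ℝ → ℝ} (hf : ContDiffOn ℝ 2 f (Icc 0 1)) (h0 : f 0 = 0)
    (h1 : f 1 = 0) :
    ∫ x in (0 : ℝ)..1, f x * iteratedDerivWithin 2 f (Icc 0 1) x =
      -∫ x in (0 : ℝ)..1, derivWithin f (Icc 0 1) x ^ 2 := by
  have hu := uniqueDiffOn_Icc (zero_lt_one (α := ℝ))
  have hd1 : ContDiffOn ℝ 1 (derivWithin f (Icc 0 1)) (Icc 0 1) :=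
    hf.derivWithin hu (by norm_num)
  have he : iteratedDerivWithin 2 f (Icc 0 1) =
      derivWithin (derivWithin f (Icc 0 1)) (Icc 0 1) := by
    rw [iteratedDerivWithin_succ, iteratedDerivWithin_one]
  have hc2 : ContinuousOn (derivWithin (derivWithin f (Icc 0 1)) (Icc 0 1)) (Icc 0 1) :=
    hd1.continuousOn_derivWithin hu le_rfl
  rw [he, intervalIntegral.integral_mul_deriv_eq_deriv_mul_of_hasDerivAt
    (u' := derivWithin f (Icc 0 1)) (v := derivWithin f (Icc 0 1))
    (by rw [uIcc_of_le zero_le_one]; exact hf.continuousOn)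
    (by rw [uIcc_of_le zero_le_one]; exact hd1.continuousOn)
    (by
      intro x hx
      simp only [zero_le_one, inf_of_le_left, sup_of_le_right] at hx
      exact hasDerivAt_derivWithin_Icc (hf.differentiableOn (by norm_num)) hx)
    (by
      intro x hx
      simp only [zero_le_one, inf_of_le_left, sup_of_le_right] at hx
      exact hasDerivAt_derivWithin_Icc (hd1.differentiableOn (by norm_num)) hx)
    (hd1.continuousOn.intervalIntegrable_of_Icc zero_le_one)
    (hc2.intervalIntegrable_of_Icc zero_le_one)]
  simp [h0, h1, pow_two]

lemma integral_le_integral_one {h : ℝ → ℝ} (hh : ContinuousOn h (Icc 0 1))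
    (hpos : ∀ x ∈ Icc (0 : ℝ) 1, 0 ≤ h x) {x : ℝ} (hx : x ∈ Icc (0 : ℝ) 1) :
    ∫ y in (0 : ℝ)..x, h y ≤ ∫ y in (0 : ℝ)..1, h y := by
  rw [← intervalIntegral.integral_add_adjacent_intervals (b := x) (c := 1)
    ((hh.mono (Icc_subset_Icc le_rfl hx.2)).intervalIntegrable_of_Icc hx.1)
    ((hh.mono (Icc_subset_Icc hx.1 le_rfl)).intervalIntegrable_of_Icc hx.2)]
  have := intervalIntegral.integral_nonneg (μ := volume) hx.2
    (fun y hy => hpos y ⟨hx.1.trans hy.1, hy.2⟩)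
  linarith

/-! ### Estimates of the residual terms. -/

/-- The pointwise bound of `f + V_L f` for a kernel `L ≥ -σ`. -/
lemma abs_add_volterra_le {L P : ℝ → ℝ → ℝ} {σ s : ℝ} {f : ℝ → ℝ}
    (hP : ContinuousOn (Function.uncurry P) triangle) (hσ : 0 ≤ σ)
    (hP0 : ∀ x y : ℝ, (x, y) ∈ triangle → 0 ≤ P x y)
    (hLP : ∀ x y : ℝ, (x, y) ∈ triangle → L x y = P x y - σ)
    (hf : ContinuousOn f (Icc 0 1)) (hs : ∀ x ∈ Icc (0 : ℝ) 1, |f x| ≤ s)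
    {x : ℝ} (hx : x ∈ Icc (0 : ℝ) 1) :
    |f x + volterra L f x| ≤
      |f x| + s * (∫ y in (0 : ℝ)..x, P x y) + σ * ∫ y in (0 : ℝ)..1, |f y| := by
  have hsub : Icc 0 x ⊆ Icc 0 1 := Icc_subset_Icc le_rfl hx.2
  have hPi : IntervalIntegrable (P x) volume 0 x :=
    (continuousOn_slice hP hx).intervalIntegrable_of_Icc hx.1
  have hfi : IntervalIntegrable (fun y => |f y|) volume 0 x :=
    (hf.abs.mono hsub).intervalIntegrable_of_Icc hx.1
  have hLc : ContinuousOn (L x) (Icc 0 x) :=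
    ((continuousOn_slice hP hx).sub continuousOn_const).congr
      fun y hy => hLP x y (mem_triangle hx hy)
  have h1 : |volterra L f x| ≤ ∫ y in (0 : ℝ)..x, |L x y * f y| :=
    intervalIntegral.abs_integral_le_integral_abs hx.1
  have h2 : ∫ y in (0 : ℝ)..x, |L x y * f y| ≤ ∫ y in (0 : ℝ)..x, (s * P x y + σ * |f y|) := by
    refine intervalIntegral.integral_mono_on hx.1
      ((hLc.mul (hf.mono hsub)).abs.intervalIntegrable_of_Icc hx.1)
      ((hPi.const_mul s).add (hfi.const_mul σ)) fun y hy => ?_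
    have ht := mem_triangle hx hy
    have hp := hP0 x y ht
    have hL : |L x y| ≤ P x y + σ := by
      rw [hLP x y ht, abs_le]; constructor <;> linarith
    -- In the `P` part `|f|` is replaced by its bound `s`; in the `σ` part it is kept, to produce `∫
    -- |f|`.
    rw [abs_mul]
    nlinarith [mul_le_mul_of_nonneg_right hL (abs_nonneg (f y)),
      mul_le_mul_of_nonneg_left (hs y (hsub hy)) hp]
  rw [intervalIntegral.integral_add (hPi.const_mul s) (hfi.const_mul σ),
    intervalIntegral.integral_const_mul, intervalIntegral.integral_const_mul] at h2
  have h3 := mul_le_mul_of_nonneg_left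
    (integral_le_integral_one hf.abs (fun y _ => abs_nonneg (f y)) hx) hσ
  have h4 := abs_add_le (f x) (volterra L f x)
  linarith

/-- The contribution of the residual terms to the energy balance. -/
lemma integral_mul_residual_le {L P δ₂ : ℝ → ℝ → ℝ} {δ₁ f u : ℝ → ℝ} {σ s d₁ d₂ : ℝ}
    (hP : ContinuousOn (Function.uncurry P) triangle) (hσ : 0 ≤ σ)
    (hP0 : ∀ x y : ℝ, (x, y) ∈ triangle → 0 ≤ P x y)
    (hLP : ∀ x y : ℝ, (x, y) ∈ triangle → L x y = P x y - σ)
    (hf : ContinuousOn f (Icc 0 1)) (hs : ∀ x ∈ Icc (0 : ℝ) 1, |f x| ≤ s)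
    (hu : ContinuousOn u (Icc 0 1)) (huf : ∀ x ∈ Icc (0 : ℝ) 1, u x = f x + volterra L f x)
    (hδ₁ : ContinuousOn δ₁ (Icc 0 1)) (hd₁ : ∀ x ∈ Icc (0 : ℝ) 1, |δ₁ x| ≤ d₁)
    (hδ₂ : ContinuousOn (Function.uncurry δ₂) triangle)
    (hd₂ : ∀ x y : ℝ, (x, y) ∈ triangle → |δ₂ x y| ≤ d₂) :
    ∫ x in (0 : ℝ)..1, f x * (δ₁ x * u x + ∫ y in (0 : ℝ)..x, δ₂ x y * u y) ≤
      (d₁ + d₂) * ((1 + σ) * (∫ x in (0 : ℝ)..1, f x ^ 2) + moment00 P * s ^ 2) := by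
  have z : (0 : ℝ) ∈ Icc (0 : ℝ) 1 := ⟨le_rfl, zero_le_one⟩
  have hs0 : 0 ≤ s := (abs_nonneg _).trans (hs 0 z)
  have hd₁0 : 0 ≤ d₁ := (abs_nonneg _).trans (hd₁ 0 z)
  have hd₂0 : 0 ≤ d₂ := (abs_nonneg _).trans (hd₂ 0 0 (mem_triangle z ⟨le_rfl, le_rfl⟩))
  set l : ℝ → ℝ := fun x => ∫ y in (0 : ℝ)..x, P x y with hl
  have hlc : ContinuousOn l (Icc 0 1) := continuousOn_integral_triangle hP
  have hl0 : ∀ x ∈ Icc (0 : ℝ) 1, 0 ≤ l x := fun x hx =>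
    intervalIntegral.integral_nonneg hx.1 fun y hy => hP0 x y (mem_triangle hx hy)
  have hm : moment00 P = ∫ x in (0 : ℝ)..1, l x := rfl
  set m := moment00 P
  have hm0 : 0 ≤ m := by rw [hm]; exact intervalIntegral.integral_nonneg zero_le_one hl0
  set I := ∫ y in (0 : ℝ)..1, |f y| with hI
  set Q := ∫ x in (0 : ℝ)..1, f x ^ 2 with hQ
  have hI0 : 0 ≤ I := intervalIntegral.integral_nonneg zero_le_one fun y _ => abs_nonneg _
  have hIQ : I ^ 2 ≤ Q := by simpa only [sq_abs] using sq_integral_le hf.abs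
  have hfi : IntervalIntegrable (fun y => |f y|) volume 0 1 :=
    hf.abs.intervalIntegrable_of_Icc zero_le_one
  have hli : IntervalIntegrable l volume 0 1 := hlc.intervalIntegrable_of_Icc zero_le_one
  have hf2i : IntervalIntegrable (fun y => f y ^ 2) volume 0 1 :=
    (hf.pow 2).intervalIntegrable_of_Icc zero_le_one
  have hIs : I ≤ s := by
    have := intervalIntegral.integral_mono_on zero_le_one hfi
      (intervalIntegrable_const (c := s)) hs
    simpa using this
  have hub : ∀ x ∈ Icc (0 : ℝ) 1, |u x| ≤ |f x| + s * l x + σ * I := fun x hx => by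
    rw [huf x hx]; exact abs_add_volterra_le hP hσ hP0 hLP hf hs hx
  have hF : ContinuousOn (Function.uncurry fun x y => δ₂ x y * u y) triangle :=
    hδ₂.mul (continuousOn_comp_snd hu)
  -- Enlarging the domain from `[0,x]` to `[0,1]` makes the bound independent of `x`, so that
  -- multiplying by `|f|` and integrating only costs a factor `I`.
  have hgb : ∀ x ∈ Icc (0 : ℝ) 1,
      |∫ y in (0 : ℝ)..x, δ₂ x y * u y| ≤ d₂ * (I + s * m + σ * I) := by
    intro x hx
    have hsub : Icc 0 x ⊆ Icc 0 1 := Icc_subset_Icc le_rfl hx.2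
    have hbc : ContinuousOn (fun y => d₂ * (|f y| + s * l y + σ * I)) (Icc 0 1) := by fun_prop
    calc |∫ y in (0 : ℝ)..x, δ₂ x y * u y|
        ≤ ∫ y in (0 : ℝ)..x, |δ₂ x y * u y| :=
          intervalIntegral.abs_integral_le_integral_abs hx.1
      _ ≤ ∫ y in (0 : ℝ)..x, d₂ * (|f y| + s * l y + σ * I) := by
          refine intervalIntegral.integral_mono_on hx.1
            ((continuousOn_slice hF hx).abs.intervalIntegrable_of_Icc hx.1)
            ((hbc.mono hsub).intervalIntegrable_of_Icc hx.1) fun y hy => ?_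
          rw [abs_mul]
          exact mul_le_mul (hd₂ x y (mem_triangle hx hy)) (hub y (hsub hy)) (abs_nonneg _) hd₂0
      _ ≤ ∫ y in (0 : ℝ)..1, d₂ * (|f y| + s * l y + σ * I) := by
          refine integral_le_integral_one hbc (fun y hy => ?_) hx
          have := hl0 y hy
          positivity
      _ = d₂ * (I + s * m + σ * I) := by
          rw [intervalIntegral.integral_const_mul,
            intervalIntegral.integral_add (hfi.add (hli.const_mul s)) intervalIntegrable_const,
            intervalIntegral.integral_add hfi (hli.const_mul s),
            intervalIntegral.integral_const_mul, ← hI, ← hm]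
          simp
  set G := d₂ * (I + s * m + σ * I) with hG
  have hmono : ∫ x in (0 : ℝ)..1, f x * (δ₁ x * u x + ∫ y in (0 : ℝ)..x, δ₂ x y * u y) ≤
      ∫ x in (0 : ℝ)..1, (d₁ * (f x ^ 2 + s ^ 2 * l x + σ * I * |f x|) + G * |f x|) := by
    refine intervalIntegral.integral_mono_on zero_le_one
      ((hf.mul ((hδ₁.mul hu).add
        (continuousOn_integral_triangle hF))).intervalIntegrable_of_Icc zero_le_one)
      ((((hf2i.add (hli.const_mul _)).add (hfi.const_mul _)).const_mul _).add
        (hfi.const_mul _)) fun x hx => ?_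
    have hlx := hl0 x hx
    have e1 : |δ₁ x * u x| ≤ d₁ * (|f x| + s * l x + σ * I) := by
      rw [abs_mul]
      exact mul_le_mul (hd₁ x hx) (hub x hx) (abs_nonneg _) hd₁0
    have e2 := (le_abs_self _).trans (abs_mul (f x)
      (δ₁ x * u x + ∫ y in (0 : ℝ)..x, δ₂ x y * u y)).le
    have e3 := (abs_add_le (δ₁ x * u x) (∫ y in (0 : ℝ)..x, δ₂ x y * u y)).trans
      (add_le_add e1 (hgb x hx))
    have e4 := mul_le_mul_of_nonneg_left e3 (abs_nonneg (f x))
    -- Bounding `|f x|` by `s` only against `l x` leaves `s² ∫ l = s² m`; the other products stay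
    -- quadratic in `f`.
    have e5 : |f x| * (d₁ * (s * l x)) ≤ s * (d₁ * (s * l x)) :=
      mul_le_mul_of_nonneg_right (hs x hx) (by positivity)
    have e6 := sq_abs (f x)
    calc _ ≤ |f x| * (d₁ * (|f x| + s * l x + σ * I) + G) := e2.trans e4
      _ = d₁ * (|f x| ^ 2 + σ * I * |f x|) + G * |f x| + |f x| * (d₁ * (s * l x)) := by ring
      _ ≤ d₁ * (|f x| ^ 2 + σ * I * |f x|) + G * |f x| + s * (d₁ * (s * l x)) := by linarith
      _ = _ := by rw [e6]; ring
  rw [intervalIntegral.integral_add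
      (((hf2i.add (hli.const_mul _)).add (hfi.const_mul _)).const_mul _) (hfi.const_mul _),
    intervalIntegral.integral_const_mul, intervalIntegral.integral_const_mul,
    intervalIntegral.integral_add (hf2i.add (hli.const_mul _)) (hfi.const_mul _),
    intervalIntegral.integral_add hf2i (hli.const_mul _), intervalIntegral.integral_const_mul,
    intervalIntegral.integral_const_mul, ← hI, ← hm, ← hQ] at hmono
  -- The remaining products are absorbed by `I² ≤ Q` and `I ≤ s`.
  have k1 : d₁ * (σ * I ^ 2) ≤ d₁ * (σ * Q) := by gcongr
  have k2 : d₂ * ((1 + σ) * I ^ 2) ≤ d₂ * ((1 + σ) * Q) := by gcongr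
  have k3 : d₂ * (s * m * I) ≤ d₂ * (s * m * s) := by gcongr
  rw [hG] at hmono
  linarith

/-! ### Decay rate. -/

/-- The arithmetic that turns the bound on the residuals into a decay rate. -/
lemma energy_rate_le {ε θ σ m D C P Q : ℝ} (hε : 0 < ε) (hθ : θ ∈ Icc (0 : ℝ) 1) (hσ : 0 ≤ σ)
    (hm : 0 ≤ m) (hD : 0 ≤ D) (hQ : 0 ≤ Q) (hPQ : Q ≤ P / 4)
    (h : D ≤ min ((ε * θ * (Real.pi ^ 2 / 4 + 1) + (C - ε)) / (1 + σ))
      (ε * (1 - θ) / (m + (σ + 1 / 2) / 4))) :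
    -ε * P - C * Q + D * ((1 + σ) * Q + m * (P / 4)) ≤ -(3 / 2 * ε) * Q := by
  obtain ⟨h1, h2⟩ := le_min_iff.mp h
  rw [le_div_iff₀ (by positivity)] at h1 h2
  have hpi : Real.pi ^ 2 / 4 ≤ 5 / 2 := by
    nlinarith [Real.pi_lt_d2, Real.pi_pos]
  have h3 : ε * θ * (Real.pi ^ 2 / 4 + 1) ≤ ε * θ * (7 / 2) :=
    mul_le_mul_of_nonneg_left (by linarith) (mul_nonneg hε.le hθ.1)
  -- The summand `(σ + 1/2) / 4` of the denominator is nonnegative and is dropped.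
  have h4 : D * m ≤ ε * (1 - θ) := by nlinarith [mul_nonneg hD hσ]
  have h5 : (D * (1 + σ)) * Q ≤ (ε * θ * (7 / 2) + (C - ε)) * Q :=
    mul_le_mul_of_nonneg_right (by linarith) hQ
  have h6 : (D * m) * (P / 4) ≤ ε * (1 - θ) * (P / 4) :=
    mul_le_mul_of_nonneg_right h4 (by linarith)
  -- After `h5` and `h6` the coefficient of `P` is `-ε (3 + θ) / 4`. With `Q ≤ P / 4` the total is
  -- at most `ε (-4 + 5 θ / 2) Q`, and `θ ≤ 1` yields `-(3 / 2) ε Q`.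
  have h7 : ε * (3 + θ) * Q ≤ ε * (3 + θ) * (P / 4) :=
    mul_le_mul_of_nonneg_left hPQ (mul_nonneg hε.le (by linarith [hθ.1]))
  have h8 : ε * (5 / 2) * (θ * Q) ≤ ε * (5 / 2) * Q :=
    mul_le_mul_of_nonneg_left (mul_le_of_le_one_left hQ hθ.2) (by positivity)
  linarith

/-! ### The `L²` norm and the time derivative of the energy. -/

/-- Gives access to Minkowski's inequality for `l2norm`. -/
lemma l2norm_eq_toReal_eLpNorm {f : ℝ → ℝ} (hf : MemLp f 2 (volume.restrict (Icc 0 1))) :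
    l2norm f = (eLpNorm f 2 (volume.restrict (Icc 0 1))).toReal := by
  rw [hf.eLpNorm_eq_integral_rpow_norm (by norm_num) (by norm_num),
    ENNReal.toReal_ofReal (by positivity), l2norm, Real.sqrt_eq_rpow,
    intervalIntegral.integral_of_le zero_le_one, ← integral_Icc_eq_integral_Ioc]
  norm_num

lemma l2norm_le_add {f g : ℝ → ℝ} (hf : MemLp f 2 (volume.restrict (Icc 0 1)))
    (hg : MemLp g 2 (volume.restrict (Icc 0 1))) :
    l2norm f ≤ l2norm (fun x => f x - g x) + l2norm g := by
  have hfg : MemLp (fun x => f x - g x) 2 (volume.restrict (Icc 0 1)) := hf.sub hg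
  rw [l2norm_eq_toReal_eLpNorm hf, l2norm_eq_toReal_eLpNorm hg, l2norm_eq_toReal_eLpNorm hfg,
    ← ENNReal.toReal_add hfg.eLpNorm_ne_top hg.eLpNorm_ne_top]
  refine ENNReal.toReal_mono (ENNReal.add_ne_top.2 ⟨hfg.eLpNorm_ne_top, hg.eLpNorm_ne_top⟩) ?_
  have := eLpNorm_add_le (p := 2) hfg.aestronglyMeasurable hg.aestronglyMeasurable (by norm_num)
  convert this using 2
  ext x
  simp

lemma memLp_of_continuousOn {f : ℝ → ℝ} (hf : ContinuousOn f (Icc 0 1)) :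
    MemLp f 2 (volume.restrict (Icc 0 1)) := by
  obtain ⟨C, hC⟩ := isCompact_Icc.exists_bound_of_continuousOn hf
  exact MemLp.of_bound (hf.aestronglyMeasurable measurableSet_Icc) C
    ((ae_restrict_iff' measurableSet_Icc).2 (ae_of_all _ hC))

/-- Differentiation of the energy `∫ w²` in time. -/
lemma hasDerivAt_integral_sq {w : ℝ → ℝ → ℝ}
    (hw : ∀ t > 0, ContinuousOn (w t) (Icc 0 1))
    (hd : ∀ t > 0, ∀ x ∈ Icc (0 : ℝ) 1, DifferentiableAt ℝ (fun s => w s x) t)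
    (hc : ContinuousOn (fun p : ℝ × ℝ => deriv (fun s => w s p.2) p.1) (Ioi 0 ×ˢ Icc 0 1))
    {t : ℝ} (ht : 0 < t) :
    HasDerivAt (fun s => ∫ x in (0 : ℝ)..1, w s x ^ 2)
      (∫ x in (0 : ℝ)..1, 2 * w t x * deriv (fun s => w s x) t) t := by
  have hcw : ∀ s > 0, ContinuousOn (fun x => deriv (fun r => w r x) s) (Icc 0 1) := fun s hs =>
    hc.comp (f := fun x => (s, x)) (by fun_prop) fun x hx => ⟨hs, hx⟩
  have hsub : Icc (t / 2) (2 * t) ×ˢ Icc (0 : ℝ) 1 ⊆ Ioi 0 ×ˢ Icc 0 1 :=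
    prod_mono (fun s hs => (half_pos ht).trans_le hs.1) subset_rfl
  obtain ⟨B, hB⟩ := (isCompact_Icc.prod isCompact_Icc).exists_bound_of_continuousOn (hc.mono hsub)
  obtain ⟨C, hC⟩ := isCompact_Icc.exists_bound_of_continuousOn (hw t ht)
  have hBp : ∀ s ∈ Icc (t / 2) (2 * t), ∀ x ∈ Icc (0 : ℝ) 1, ‖deriv (fun r => w r x) s‖ ≤ B :=
    fun s hs x hx => hB (s, x) ⟨hs, hx⟩
  have htm : t ∈ Icc (t / 2) (2 * t) := ⟨by linarith, by linarith⟩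
  -- Joint continuity is assumed for `w_t` only, so the bound on `w` near time `t` comes from the
  -- mean value inequality on `[t/2, 2t]`, where `|s - t| ≤ t`.
  have hC' : ∀ s ∈ Icc (t / 2) (2 * t), ∀ x ∈ Icc (0 : ℝ) 1, ‖w s x‖ ≤ C + B * t := by
    intro s hs x hx
    have h1 := (convex_Icc (t / 2) (2 * t)).norm_image_sub_le_of_norm_deriv_le
      (f := fun r => w r x) (fun r hr => hd r ((half_pos ht).trans_le hr.1) x hx)
      (fun r hr => hBp r hr x hx) htm hs
    have hB0 : 0 ≤ B := (norm_nonneg _).trans (hBp s hs x hx)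
    have h2 : ‖s - t‖ ≤ t := by
      rw [Real.norm_eq_abs, abs_le]; constructor <;> linarith [hs.1, hs.2]
    have h3 := norm_le_norm_add_norm_sub' (w s x) (w t x)
    have h4 := mul_le_mul_of_nonneg_left h2 hB0
    have h5 := hC x hx
    linarith
  have hnhds : Icc (t / 2) (2 * t) ∈ 𝓝 t := Icc_mem_nhds (by linarith) (by linarith)
  have hIoc : uIoc (0 : ℝ) 1 ⊆ Icc 0 1 := by
    rw [uIoc_of_le zero_le_one]; exact Ioc_subset_Icc_self
  refine (intervalIntegral.hasDerivAt_integral_of_dominated_loc_of_deriv_le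
    (F := fun s x => w s x ^ 2) (F' := fun s x => 2 * w s x * deriv (fun r => w r x) s)
    (bound := fun _ => 2 * (C + B * t) * B) hnhds ?_ ?_ ?_ ?_ ?_ ?_).2
  · filter_upwards [hnhds] with s hs
    exact (((hw s ((half_pos ht).trans_le hs.1)).pow 2).mono hIoc).aestronglyMeasurable
      measurableSet_uIoc
  · exact ((hw t ht).pow 2).intervalIntegrable_of_Icc zero_le_one
  · exact (((continuousOn_const.mul (hw t ht)).mul (hcw t ht)).mono hIoc).aestronglyMeasurable
      measurableSet_uIoc
  · refine ae_of_all _ fun x hx s hs => ?_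
    have h1 := hC' s hs x (hIoc hx)
    have h2 := hBp s hs x (hIoc hx)
    have h3 : 0 ≤ C + B * t := (norm_nonneg _).trans h1
    rw [norm_mul, norm_mul, Real.norm_ofNat]
    gcongr
  · exact intervalIntegrable_const
  · refine ae_of_all _ fun x hx s hs => ?_
    refine ((hd s ((half_pos ht).trans_le hs.1) x (hIoc hx)).hasDerivAt.pow 2).congr_deriv ?_
    simp

/-! ### Energy balance and decay. -/

/-- The energy balance of the transformed system, with the residuals estimated. -/
lemma integral_mul_time_deriv_le {ε σ cmin : ℝ} {c δ₀ δ₁ : ℝ → ℝ} {K L P δ₂ : ℝ → ℝ → ℝ}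
    {u w : ℝ → ℝ → ℝ} (hc : ContinuousOn c (Icc 0 1)) (hL : IsInverseKernel K L)
    (hP : ContinuousOn (Function.uncurry P) triangle) (hσ : 0 ≤ σ)
    (hP0 : ∀ x y : ℝ, (x, y) ∈ triangle → 0 ≤ P x y)
    (hLP : ∀ x y : ℝ, (x, y) ∈ triangle → L x y = P x y - σ)
    (hcge : ∀ x ∈ Icc (0 : ℝ) 1, cmin ≤ c x) (hδ₀ : ∀ x ∈ Icc (0 : ℝ) 1, δ₀ x = 0)
    (hδ₁ : ContinuousOn δ₁ (Icc 0 1)) (hδ₂ : ContinuousOn (Function.uncurry δ₂) triangle)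
    (h : IsTransformedSolution ε c K δ₀ δ₁ δ₂ u w) {t : ℝ} (ht : 0 < t) :
    let A := ∫ x in (0 : ℝ)..1, derivWithin (w t) (Icc 0 1) x ^ 2
    let Q := ∫ x in (0 : ℝ)..1, w t x ^ 2
    ∫ x in (0 : ℝ)..1, w t x * deriv (fun s => w s x) t ≤
      -ε * A - cmin * Q +
        (maxAbs δ₁ + maxAbsTriangle δ₂) * ((1 + σ) * Q + moment00 P * (A / 4)) := by
  intro A Q
  have hf2 := h.contDiffOn_w t ht
  have hf : ContinuousOn (w t) (Icc 0 1) := hf2.continuousOn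
  have hu : ContinuousOn (u t) (Icc 0 1) := (h.contDiffOn_u t ht).continuousOn
  have hA0 : 0 ≤ A := intervalIntegral.integral_nonneg zero_le_one fun x _ => sq_nonneg _
  have hs : ∀ x ∈ Icc (0 : ℝ) 1, |w t x| ≤ Real.sqrt (A / 4) := fun x hx => by
    refine Real.abs_le_sqrt ?_
    have := four_mul_sq_le (hf2.of_le (by norm_num)) (h.boundary_zero t ht)
      (h.boundary_one t ht) hx
    change 4 * w t x ^ 2 ≤ A at this
    linarith
  have hR := integral_mul_residual_le hP hσ hP0 hLP hf hs hu
    ((hL.2 (u t) (w t) hu hf).1 (h.transformation t ht)) hδ₁ (fun x hx => abs_le_maxAbs hδ₁ hx)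
    hδ₂ (fun x y hxy => abs_le_maxAbsTriangle hδ₂ hxy)
  rw [Real.sq_sqrt (by positivity)] at hR
  have hF : ContinuousOn (Function.uncurry fun x y => δ₂ x y * u t y) triangle :=
    hδ₂.mul (continuousOn_comp_snd hu)
  have hRc : ContinuousOn (fun x => w t x *
      (δ₁ x * u t x + ∫ y in (0 : ℝ)..x, δ₂ x y * u t y)) (Icc 0 1) :=
    hf.mul ((hδ₁.mul hu).add (continuousOn_integral_triangle hF))
  have hcc : ContinuousOn (fun x => c x * w t x ^ 2) (Icc 0 1) := hc.mul (hf.pow 2)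
  have hdc : ContinuousOn (fun x => w t x * iteratedDerivWithin 2 (w t) (Icc 0 1) x) (Icc 0 1) :=
    hf.mul (hf2.continuousOn_iteratedDerivWithin (by norm_num) (uniqueDiffOn_Icc one_pos))
  have heq : ∫ x in (0 : ℝ)..1, w t x * deriv (fun s => w s x) t =
      ∫ x in (0 : ℝ)..1, (ε * (w t x * iteratedDerivWithin 2 (w t) (Icc 0 1) x) -
        c x * w t x ^ 2 + w t x * (δ₁ x * u t x + ∫ y in (0 : ℝ)..x, δ₂ x y * u t y)) := by
    refine intervalIntegral.integral_congr_ae ?_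
    -- The equation holds on the open interval only; the endpoint 1 is a null set.
    filter_upwards [compl_mem_ae_iff.2 (measure_singleton (μ := volume) (1 : ℝ))] with x hx1 hx
    rw [uIoc_of_le zero_le_one] at hx
    have hx' : x ∈ Ioo (0 : ℝ) 1 := ⟨hx.1, lt_of_le_of_ne hx.2 hx1⟩
    have he := h.equation t ht x hx'
    rw [hδ₀ x (Ioo_subset_Icc_self hx')] at he
    rw [show deriv (fun s => w s x) t = ε * iteratedDerivWithin 2 (w t) (Icc 0 1) x - c x * w t x +
      (δ₁ x * u t x + ∫ y in (0 : ℝ)..x, δ₂ x y * u t y) by linarith]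
    ring
  have hdi := (hdc.intervalIntegrable_of_Icc (μ := volume) zero_le_one).const_mul ε
  have hci := hcc.intervalIntegrable_of_Icc (μ := volume) zero_le_one
  rw [intervalIntegral.integral_add (hdi.sub hci) (hRc.intervalIntegrable_of_Icc zero_le_one),
    intervalIntegral.integral_sub hdi hci, intervalIntegral.integral_const_mul,
    integral_mul_second_deriv hf2 (h.boundary_zero t ht) (h.boundary_one t ht)] at heq
  have hcQ : cmin * Q ≤ ∫ x in (0 : ℝ)..1, c x * w t x ^ 2 := by
    rw [← intervalIntegral.integral_const_mul]
    exact intervalIntegral.integral_mono_on zero_le_one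
      ((continuousOn_const.mul (hf.pow 2)).intervalIntegrable_of_Icc zero_le_one) hci
      fun x hx => mul_le_mul_of_nonneg_right (hcge x hx) (sq_nonneg _)
  change _ = ε * -A - _ + _ at heq
  linarith

/-- A differential inequality for the energy at positive times gives exponential decay from
an initial state attained in the `L²` sense. -/
lemma l2norm_le_exp_of_energy {w : ℝ → ℝ → ℝ} {E' : ℝ → ℝ} {α : ℝ}
    (hw0 : MemLp (w 0) 2 (volume.restrict (Icc 0 1)))
    (hlim : Tendsto (fun t => l2norm (fun x => w t x - w 0 x)) (𝓝[>] 0) (𝓝 0))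
    (hw : ∀ t > 0, ContinuousOn (w t) (Icc 0 1))
    (hE : ∀ t > 0, HasDerivAt (fun s => ∫ x in (0 : ℝ)..1, w s x ^ 2) (E' t) t)
    (hle : ∀ t > 0, E' t ≤ -(2 * α) * ∫ x in (0 : ℝ)..1, w t x ^ 2) {t : ℝ} (ht : 0 ≤ t) :
    l2norm (w t) ≤ Real.exp (-α * t) * l2norm (w 0) := by
  rcases ht.eq_or_lt with rfl | ht
  · simp
  set E : ℝ → ℝ := fun s => ∫ x in (0 : ℝ)..1, w s x ^ 2
  have hG : ∀ s > 0, HasDerivAt (fun s => E s * Real.exp (2 * α * s))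
      (E' s * Real.exp (2 * α * s) + E s * (Real.exp (2 * α * s) * (2 * α))) s := fun s hs => by
    have h1 : HasDerivAt (fun s : ℝ => 2 * α * s) (2 * α) s := by
      simpa using (hasDerivAt_id s).const_mul (2 * α)
    exact (hE s hs).mul h1.exp
  -- Gronwall with integrating factor `exp (2 α s)`, on positive times only: continuity of the
  -- energy at 0 is not given.
  have hanti : AntitoneOn (fun s => E s * Real.exp (2 * α * s)) (Ioi 0) := by
    refine antitoneOn_of_deriv_nonpos (convex_Ioi 0)
      (fun s hs => (hG s hs).continuousAt.continuousWithinAt) ?_ ?_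
    · rw [interior_Ioi]
      exact fun s hs => (hG s hs).differentiableAt.differentiableWithinAt
    · rw [interior_Ioi]
      intro s hs
      rw [(hG s hs).deriv]
      have h2 := mul_le_mul_of_nonneg_right (hle s hs) (Real.exp_pos (2 * α * s)).le
      change _ ≤ -(2 * α) * E s * _ at h2
      linarith
  have hexp : ∀ r : ℝ, Real.sqrt (Real.exp (2 * α * r)) = Real.exp (α * r) := fun r => by
    rw [show 2 * α * r = α * r + α * r by ring, Real.exp_add,
      Real.sqrt_mul_self (Real.exp_pos _).le]
  -- Time `t` is compared with an earlier `s > 0`; the triangle inequality brings in the initial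
  -- state, and then `s ↓ 0`.
  have hstep : ∀ s ∈ Ioc 0 t, l2norm (w t) * Real.exp (α * t) ≤
      (l2norm (fun x => w s x - w 0 x) + l2norm (w 0)) * Real.exp (α * s) := by
    intro s hs
    have h1 := Real.sqrt_le_sqrt (hanti hs.1 ht hs.2)
    simp only at h1
    rw [Real.sqrt_mul' _ (Real.exp_pos _).le, Real.sqrt_mul' _ (Real.exp_pos _).le,
      hexp, hexp] at h1
    exact h1.trans (mul_le_mul_of_nonneg_right
      (l2norm_le_add (memLp_of_continuousOn (hw s hs.1)) hw0) (Real.exp_pos _).le)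
  have hexp_lim : Tendsto (fun s => Real.exp (α * s)) (𝓝[>] 0) (𝓝 1) := by
    have : Continuous fun s : ℝ => Real.exp (α * s) := by fun_prop
    simpa using (this.tendsto 0).mono_left nhdsWithin_le_nhds
  have hl : Tendsto (fun s => (l2norm (fun x => w s x - w 0 x) + l2norm (w 0)) *
      Real.exp (α * s)) (𝓝[>] 0) (𝓝 (l2norm (w 0))) := by
    simpa using (hlim.add_const (l2norm (w 0))).mul hexp_lim
  have hfin : l2norm (w t) * Real.exp (α * t) ≤ l2norm (w 0) := by
    refine ge_of_tendsto hl ?_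
    filter_upwards [Ioc_mem_nhdsGT ht] with s hs using hstep s hs
  rw [neg_mul, Real.exp_neg, inv_mul_eq_div, le_div_iff₀ (Real.exp_pos _)]
  exact hfin

end Backstepping

/-! ### The stability theorem. -/

theorem proposition1
    (ε : ℝ) (hε : 0 < ε)
    (lam c : ℝ → ℝ)
    (hlam : ContinuousOn lam (Set.Icc 0 1)) (hc : ContinuousOn c (Set.Icc 0 1))
    (K L Lpos : ℝ → ℝ → ℝ)
    (hK : ContDiffOn ℝ 2 (Function.uncurry K) Backstepping.triangle)
    (hL : Backstepping.IsInverseKernel K L)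
    (σ : ℝ) (hσ : 0 ≤ σ)
    (hLpos : ∀ x y : ℝ, (x, y) ∈ Backstepping.triangle → 0 ≤ Lpos x y)
    (hdecomp : ∀ x y : ℝ, (x, y) ∈ Backstepping.triangle → L x y = Lpos x y - σ)
    (cmin : ℝ) (hcmin : -(ε * Real.pi ^ 2 / 4) < cmin)
    (hcge : ∀ x ∈ Set.Icc (0 : ℝ) 1, cmin ≤ c x)
    (hδ₀ : ∀ x ∈ Set.Icc (0 : ℝ) 1, Backstepping.residual0 ε K x = 0)
    (δ₂ : ℝ → ℝ → ℝ)
    (hδ₂ : δ₂ = Backstepping.residual2 ε lam c K ∨ δ₂ = Backstepping.residual2' ε lam c K)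
    (hbound : ∃ θ ∈ Set.Icc (0 : ℝ) 1,
      Backstepping.maxAbs (Backstepping.residual1 ε lam c K) + Backstepping.maxAbsTriangle δ₂ ≤
        min ((ε * θ * (Real.pi ^ 2 / 4 + 1) + (cmin - ε)) / (1 + σ))
          (ε * (1 - θ) / (Backstepping.moment00 Lpos + (σ + 1 / 2) / 4))) :
    Backstepping.IsExponentiallyStable ε c K (Backstepping.residual0 ε K)
      (Backstepping.residual1 ε lam c K) δ₂ := by
  open Backstepping Set MeasureTheory in
  obtain ⟨θ, hθ, hD⟩ := hbound
  have hδ₁ := continuousOn_residual1 (ε := ε) hlam hc hK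
  -- The two variants of `δ₂` differ only in this continuity proof; afterwards only `maxAbsTriangle
  -- δ₂` matters.
  have hδ₂c : ContinuousOn (Function.uncurry δ₂) triangle := by
    rcases hδ₂ with rfl | rfl
    · exact continuousOn_residual2 hlam hc hK
    · exact continuousOn_residual2' hlam hc hK
  have hP : ContinuousOn (Function.uncurry Lpos) triangle :=
    (hL.1.add continuousOn_const).congr fun p hp =>
      (sub_eq_iff_eq_add.1 (hdecomp p.1 p.2 hp).symm)
  have z : (0 : ℝ) ∈ Icc (0 : ℝ) 1 := ⟨le_rfl, zero_le_one⟩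
  have hD0 : 0 ≤ maxAbs (residual1 ε lam c K) + maxAbsTriangle δ₂ :=
    add_nonneg ((abs_nonneg _).trans (abs_le_maxAbs hδ₁ z))
      ((abs_nonneg _).trans (abs_le_maxAbsTriangle hδ₂c (mem_triangle z ⟨le_rfl, le_rfl⟩)))
  have hm : 0 ≤ moment00 Lpos := intervalIntegral.integral_nonneg zero_le_one fun x hx =>
    intervalIntegral.integral_nonneg hx.1 fun y hy => hLpos x y (mem_triangle hx hy)
  refine ⟨1, one_pos, 3 / 2 * ε, by positivity, fun u w h t ht => ?_⟩
  rw [one_mul]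
  refine l2norm_le_exp_of_energy h.initial_memLp h.initial_tendsto
    (fun s hs => (h.contDiffOn_w s hs).continuousOn)
    (fun s hs => hasDerivAt_integral_sq (fun r hr => (h.contDiffOn_w r hr).continuousOn)
      h.differentiable_time h.continuousOn_time_deriv hs) (fun s hs => ?_) ht
  have hbal := integral_mul_time_deriv_le hc hL hP hσ hLpos hdecomp hcge hδ₀ hδ₁ hδ₂c h hs
  have hf := h.contDiffOn_w s hs
  have hQ : 0 ≤ ∫ x in (0 : ℝ)..1, w s x ^ 2 :=
    intervalIntegral.integral_nonneg zero_le_one fun x _ => sq_nonneg _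
  -- Integrating the pointwise bound over `[0,1]` gives the Poincaré inequality with constant `1/4`.
  have hQA : ∫ x in (0 : ℝ)..1, w s x ^ 2 ≤
      (∫ x in (0 : ℝ)..1, derivWithin (w s) (Icc 0 1) x ^ 2) / 4 := by
    have := intervalIntegral.integral_mono_on zero_le_one
      ((hf.continuousOn.pow 2).intervalIntegrable_of_Icc (μ := volume) zero_le_one)
      (intervalIntegrable_const (c := (∫ x in (0 : ℝ)..1, derivWithin (w s) (Icc 0 1) x ^ 2) / 4))
      fun x hx => by
        have := four_mul_sq_le (hf.of_le (by norm_num)) (h.boundary_zero s hs)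
          (h.boundary_one s hs) hx
        rw [le_div_iff₀ (by norm_num), Pi.pow_apply]
        linarith
    simpa using this
  have hrate := energy_rate_le hε hθ hσ hm hD0 hQ hQA hD
  simp_rw [mul_assoc (2 : ℝ)]
  rw [intervalIntegral.integral_const_mul]
  linarith
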